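/- Let $\Gamma$ be a finite simplicial graph with vertex set $V(\Gamma)$ such that $|V(\Gamma)|\ge 4$ and both $\Gamma$ and its complement graph $\bar\Gamma$ are connected. Let $$A(\Gamma)=\langle\, v\in V(\Gamma)\mid vw=wv \text{ whenever } \{v,w\} \text{ is an edge of } \Gamma\,\rangle$$ be the right-angled Artin group of $\Gamma$. Let $\Gamma^e$ be its extension graph: the vertices are the elements $v^g=g^{-1}vg$ of $A(\Gamma)$ with $v\in V(\Gamma)$ and $g\in A(\Gamma)$, and two distinct vertices are adjacent if and only if they commute in $A(\Gamma)$. Let $d$ be the graph metric of $\Gamma^e$, and let $A(\Gamma)$ act on $\Gamma^e$ from the right by conjugation, $v^h\cdot g=v^{hg}$. Then $\Gamma^e$ is connected, and for every $g\in A(\Gamma)$ the asymptotic translation length $$\tau(g)=\lim_{n\to\infty}\frac{d(x\cdot g^n,x)}{n}$$ exists and does not depend on the vertex $x$ of $\Gamma^e$. Some $g\in A(\Gamma)$ has $\tau(g)>0$, and the minimal asymptotic translation length $$\mathcal L_{(\Gamma^e,d)}(A(\Gamma))=\inf\{\tau(g): g\in A(\Gamma),\ \tau(g)>0\}$$ satisfies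 $$\mathcal L_{(\Gamma^e,d)}(A(\Gamma))\ \ge\ \frac{1}{|V(\Gamma)|-2}.$$ -/

import Mathlib

open scoped RightActions Topology

namespace ExtensionGraph

/-- Defining relators of the right-angled Artin group: commutators of adjacent vertices. -/
def raagRels {V : Type*} (Γ : SimpleGraph V) : Set (FreeGroup V) :=
  {r | ∃ v w : V, Γ.Adj v w ∧ r =
    FreeGroup.of v * FreeGroup.of w * (FreeGroup.of v)⁻¹ * (FreeGroup.of w)⁻¹}

/-- The right-angled Artin group `A(Γ)`. -/
abbrev RAAG {V : Type*} (Γ : SimpleGraph V) : Type _ := PresentedGroup (raagRels Γ)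

/-- The generator of `A(Γ)` given by a vertex of `Γ`. -/
def RAAG.gen {V : Type*} (Γ : SimpleGraph V) (v : V) : RAAG Γ := PresentedGroup.of v

/-- Vertices of the extension graph: the elements `v^g = g⁻¹ v g` of `A(Γ)`. -/
def ExtVertex {V : Type*} (Γ : SimpleGraph V) : Type _ :=
  {a : RAAG Γ // ∃ (v : V) (g : RAAG Γ), a = g⁻¹ * RAAG.gen Γ v * g}

/-- The extension graph `Γ^e`: distinct vertices are adjacent iff they commute in `A(Γ)`. -/
def extensionGraph {V : Type*} (Γ : SimpleGraph V) : SimpleGraph (ExtVertex Γ) where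
  Adj x y := x ≠ y ∧ x.1 * y.1 = y.1 * x.1
  symm := ⟨fun _ _ h => ⟨h.1.symm, h.2.symm⟩⟩
  loopless := ⟨fun _ h => h.1 rfl⟩

/-- The right action of `A(Γ)` on the vertices of `Γ^e` by conjugation,
`x <• g = g⁻¹ x g`, so that `v^h <• g = v^(hg)`. -/
instance {V : Type*} (Γ : SimpleGraph V) : MulAction (RAAG Γ)ᵐᵒᵖ (ExtVertex Γ) where
  smul g x := ⟨g.unop⁻¹ * x.1 * g.unop, by
    obtain ⟨v, h, hx⟩ := x.2
    exact ⟨v, h * g.unop, by rw [hx]; group⟩⟩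
  one_smul x := Subtype.ext (by
    change (1 : RAAG Γ)⁻¹ * x.1 * 1 = x.1
    group)
  mul_smul g h x := Subtype.ext (by
    change (h.unop * g.unop)⁻¹ * x.1 * (h.unop * g.unop)
      = g.unop⁻¹ * (h.unop⁻¹ * x.1 * h.unop) * g.unop
    group)

/-- `t` is the asymptotic translation length of `g` for a right action on the vertices of the
graph `X` with its graph metric: `d(x gⁿ, x) / n → t` for every base vertex `x`. -/
def IsTranslationLength {G P : Type*} [Group G] [MulAction Gᵐᵒᵖ P] (X : SimpleGraph P)
    (g : G) (t : ℝ) : Prop :=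
  ∀ x : P, Filter.Tendsto (fun n : ℕ => (X.dist (x <• g ^ n) x : ℝ) / n) Filter.atTop (𝓝 t)

/-- The positive asymptotic translation lengths of elements of the subgroup `H`. -/
def loxodromicLengths {G P : Type*} [Group G] [MulAction Gᵐᵒᵖ P] (X : SimpleGraph P)
    (H : Subgroup G) : Set ℝ :=
  {t | 0 < t ∧ ∃ h ∈ H, IsTranslationLength X h t}

/-- The minimal asymptotic translation length of the subgroup `H`. -/
noncomputable def minTranslationLength {G P : Type*} [Group G] [MulAction Gᵐᵒᵖ P]
    (X : SimpleGraph P) (H : Subgroup G) : ℝ :=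
  sInf (loxodromicLengths X H)

end ExtensionGraph

/-! Conjugate `g` so that it is spelled by a word `W` all of whose powers are reduced. If the
support of `W` lies in one closed star, or splits into two mutually adjacent nonempty parts, some
vertex of the extension graph has a bounded orbit and `τ(g) = 0`. Otherwise the support is connected
in the complement graph, and the task is to show `n ≤ (|V| - 2) · d(v · gⁿ, v)`.

Progress along `L = Wⁿ` is measured by an action of `A(Γ)` on states `V → ℕ`, where the generator
`a` changes only coordinate `a`, in a way depending only on the coordinates that do not commute with
`a`. For reduced `L` it can be arranged that every suffix of `L` carries the zero state to its
vector of letter counts (`wordRep_suffix`), and that non-commuting coordinates of any state in the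
orbit of zero are counts in a common suffix of `L` (`isValidState_wordRep`). Dividing counts by
those of `W` and rounding up gives levels; those of non-commuting vertices in the support differ by
at most one (`level_le_level_add_one`).

The centralizer of `v` is generated by its star, so the levels off the star of `v` depend only on
the vertex `v^h`. Adjacent vertices share a conjugator (`exists_common_conjugator`), so crossing an
edge compares levels within one state. A path in the complement would give an increase of at most
`|V| - 1`; a counting argument saves one (`le_add_card_sub_two`). A walk from `v` to `v · gⁿ` raises
the level from `0` to `n`, which gives the bound. -/

namespace ExtensionGraph

/-! ### Words, reducedness and cyclic reduction. -/

section Words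

variable {V : Type*} (Γ : SimpleGraph V)

/-- The element of `A(Γ)` given by a signed vertex. -/
def letter (l : V × Bool) : RAAG Γ := cond l.2 (RAAG.gen Γ l.1) (RAAG.gen Γ l.1)⁻¹

/-- The element of `A(Γ)` spelled by a word in signed vertices. -/
def wordProd (L : List (V × Bool)) : RAAG Γ := (L.map (letter Γ)).prod

@[simp] lemma wordProd_nil : wordProd Γ [] = 1 := rfl

@[simp] lemma wordProd_cons (l : V × Bool) (L : List (V × Bool)) :
    wordProd Γ (l :: L) = letter Γ l * wordProd Γ L := by
  simp [wordProd]

@[simp] lemma wordProd_append (L M : List (V × Bool)) :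
    wordProd Γ (L ++ M) = wordProd Γ L * wordProd Γ M := by
  simp [wordProd]

lemma letter_not (a : V) (e : Bool) : letter Γ (a, !e) = (letter Γ (a, e))⁻¹ := by
  cases e <;> simp [letter]

lemma wordProd_invRev (L : List (V × Bool)) :
    wordProd Γ (FreeGroup.invRev L) = (wordProd Γ L)⁻¹ := by
  induction L with
  | nil => simp [FreeGroup.invRev]
  | cons l L ih =>
    have : FreeGroup.invRev (l :: L) = FreeGroup.invRev L ++ [(l.1, !l.2)] := by
      simp [FreeGroup.invRev]
    rw [this]
    simp [ih, letter_not]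

lemma wordProd_surjective : Function.Surjective (wordProd Γ) := by
  intro g
  have hg : g ∈ Subgroup.closure (Set.range (PresentedGroup.of (rels := raagRels Γ))) := by
    rw [PresentedGroup.closure_range_of]; trivial
  induction hg using Subgroup.closure_induction with
  | mem x hx =>
    obtain ⟨v, rfl⟩ := hx
    exact ⟨[(v, true)], by simp [letter, RAAG.gen]⟩
  | one => exact ⟨[], rfl⟩
  | mul x y _ _ hx hy =>
    obtain ⟨L, rfl⟩ := hx
    obtain ⟨M, rfl⟩ := hy
    exact ⟨L ++ M, by simp⟩
  | inv x _ hx =>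
    obtain ⟨L, rfl⟩ := hx
    exact ⟨FreeGroup.invRev L, wordProd_invRev Γ L⟩

variable {Γ}

lemma gen_commute {v w : V} (h : Γ.Adj v w) : Commute (RAAG.gen Γ v) (RAAG.gen Γ w) := by
  have : PresentedGroup.mk (raagRels Γ) (FreeGroup.of v * FreeGroup.of w * (FreeGroup.of v)⁻¹ *
      (FreeGroup.of w)⁻¹) = 1 :=
    PresentedGroup.one_of_mem ⟨v, w, h, rfl⟩
  simp only [map_mul, map_inv] at this
  change RAAG.gen Γ v * RAAG.gen Γ w * (RAAG.gen Γ v)⁻¹ * (RAAG.gen Γ w)⁻¹ = 1 at this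
  have h2 := mul_inv_eq_one.mp this
  exact mul_inv_eq_iff_eq_mul.mp h2

lemma letter_commute {l m : V × Bool} (h : Γ.Adj l.1 m.1 ∨ m.1 = l.1) :
    Commute (letter Γ l) (letter Γ m) := by
  obtain ⟨v, e⟩ := l
  obtain ⟨w, f⟩ := m
  have : Commute (RAAG.gen Γ v) (RAAG.gen Γ w) := by
    rcases h with h | h
    · exact gen_commute h
    · simp only at h; subst h; exact Commute.refl _
  cases e <;> cases f <;> simp [letter, this]

lemma letter_commute_wordProd {l : V × Bool} {Q : List (V × Bool)}
    (h : ∀ q ∈ Q, Γ.Adj l.1 q.1 ∨ q.1 = l.1) : Commute (letter Γ l) (wordProd Γ Q) := by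
  induction Q with
  | nil => exact Commute.one_right _
  | cons q Q ih =>
    rw [wordProd_cons]
    exact (letter_commute (h q (by simp))).mul_right (ih fun r hr => h r (by simp [hr]))

variable (Γ) in
/-- A word is reduced if it has no pair of cancelling letters that can be brought together by
commutations. -/
def IsReducedWord (L : List (V × Bool)) : Prop :=
  ∀ (P Q R : List (V × Bool)) (a : V) (e : Bool), L = P ++ (a, e) :: (Q ++ (a, !e) :: R) →
    ∃ q ∈ Q, ¬ Γ.Adj a q.1

lemma wordProd_cancel {P Q R : List (V × Bool)} {a : V} {e : Bool} (h : ∀ q ∈ Q, Γ.Adj a q.1) :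
    wordProd Γ (P ++ (a, e) :: (Q ++ (a, !e) :: R)) = wordProd Γ (P ++ (Q ++ R)) := by
  have hc : Commute (letter Γ (a, e)) (wordProd Γ Q) :=
    letter_commute_wordProd fun q hq => Or.inl (h q hq)
  simp only [wordProd_append, wordProd_cons, letter_not]
  rw [← mul_assoc (letter Γ (a, e)), hc.eq]
  group

lemma exists_shorter_of_not_isReducedWord {L : List (V × Bool)} (h : ¬ IsReducedWord Γ L) :
    ∃ M, M.length < L.length ∧ wordProd Γ M = wordProd Γ L := by
  simp only [IsReducedWord] at h
  push Not at h
  obtain ⟨P, Q, R, a, e, rfl, hQ⟩ := h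
  exact ⟨P ++ (Q ++ R), by simp, (wordProd_cancel hQ).symm⟩

/-- The `n`-th power of a word. -/
def wordPow (W : List (V × Bool)) : ℕ → List (V × Bool)
  | 0 => []
  | n + 1 => W ++ wordPow W n

lemma wordProd_wordPow (W : List (V × Bool)) (n : ℕ) :
    wordProd Γ (wordPow W n) = wordProd Γ W ^ n := by
  induction n with
  | zero => simp [wordPow]
  | succ n ih => simp [wordPow, ih, pow_succ']

lemma mem_wordPow {W : List (V × Bool)} {n : ℕ} {l : V × Bool} (h : l ∈ wordPow W n) : l ∈ W := by
  induction n with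
  | zero => simp [wordPow] at h
  | succ n ih =>
    rcases List.mem_append.mp h with h | h
    · exact h
    · exact ih h

/-- A word whose first and last occurrences of a vertex can be cancelled cyclically is conjugate
to a shorter one. -/
lemma exists_shorter_conj {W P Q Q' R : List (V × Bool)} {a : V} {e : Bool}
    (h₁ : W = P ++ (a, e) :: Q) (h₂ : W = Q' ++ (a, !e) :: R)
    (hQ : ∀ q ∈ Q, Γ.Adj a q.1) (hQ' : ∀ q ∈ Q', Γ.Adj a q.1) :
    ∃ (M : List (V × Bool)) (k : RAAG Γ),
      wordProd Γ M = k⁻¹ * wordProd Γ W * k ∧ M.length < W.length := by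
  have h := h₁.symm.trans h₂
  rw [List.append_eq_append_iff] at h
  rcases h with ⟨S, rfl, hS⟩ | ⟨S, rfl, hS⟩
  · rcases List.cons_eq_append_iff.mp hS with ⟨rfl, h⟩ | ⟨T, rfl, h⟩
    · simp at h
    · exact absurd (hQ' (a, e) (by simp)) (Γ.irrefl)
  · rcases List.cons_eq_append_iff.mp hS with ⟨rfl, h⟩ | ⟨T, rfl, rfl⟩
    · simp at h
    · have hc : Commute (letter Γ (a, e)) (wordProd Γ Q) :=
        letter_commute_wordProd fun q hq => Or.inl (hQ q hq)
      have hc' : Commute (letter Γ (a, e)) (wordProd Γ Q') :=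
        letter_commute_wordProd fun q hq => Or.inl (hQ' q hq)
      -- Here `W = Q' a⁻¹ T a Q`, up to the sign of `a`, with `a` commuting with `Q` and `Q'`, so
      -- conjugation removes both letters.
      refine ⟨Q' ++ (T ++ Q), (letter Γ (a, e))⁻¹, ?_, ?_⟩
      · rw [h₂]
        simp only [wordProd_append, wordProd_cons, letter_not, inv_inv]
        have h3 : letter Γ (a, e) * wordProd Γ Q * (letter Γ (a, e))⁻¹ = wordProd Γ Q := by
          rw [hc.eq]; group
        calc wordProd Γ Q' * (wordProd Γ T * wordProd Γ Q)
            = wordProd Γ Q' * (wordProd Γ T *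
                (letter Γ (a, e) * wordProd Γ Q * (letter Γ (a, e))⁻¹)) := by rw [h3]
          _ = (wordProd Γ Q' * letter Γ (a, e)) * (letter Γ (a, e))⁻¹ * (wordProd Γ T *
                (letter Γ (a, e) * wordProd Γ Q * (letter Γ (a, e))⁻¹)) := by group
          _ = _ := by rw [← hc'.eq]; group
      · rw [h₂]; simp

/-- A word of minimal length in its conjugacy class has reduced powers. -/
lemma isReducedWord_wordPow {W : List (V × Bool)}
    (hW : ∀ (M : List (V × Bool)) (k : RAAG Γ), wordProd Γ M = k⁻¹ * wordProd Γ W * k →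
      W.length ≤ M.length) (n : ℕ) : IsReducedWord Γ (wordPow W n) := by
  have hred : IsReducedWord Γ W := by
    by_contra h
    obtain ⟨M, hlt, hM⟩ := exists_shorter_of_not_isReducedWord h
    have := hW M 1 (by simp [hM])
    omega
  induction n with
  | zero =>
    intro P Q R a e h
    simp [wordPow] at h
  | succ n ih =>
    intro P Q R a e h
    by_contra! hQ
    rw [wordPow, List.append_eq_append_iff] at h
    rcases h with ⟨S, rfl, hS⟩ | ⟨S, hS, h⟩
    · obtain ⟨q, hq, hn⟩ := ih S Q R a e hS
      exact hn (hQ q hq)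
    rcases List.cons_eq_append_iff.mp h with ⟨rfl, h⟩ | ⟨T, rfl, -⟩
    · obtain ⟨q, hq, hn⟩ := ih [] Q R a e (by simpa using h.symm)
      exact hn (hQ q hq)
    have h : Q ++ (a, !e) :: R = T ++ wordPow W n := by simpa using h
    have key : (∃ U, T = Q ++ (a, !e) :: U) ∨
        ∃ U, Q = T ++ U ∧ wordPow W n = U ++ (a, !e) :: R := by
      rcases List.append_eq_append_iff.mp h with ⟨U, rfl, hU⟩ | ⟨U, rfl, hU⟩
      · rcases List.cons_eq_append_iff.mp hU with ⟨rfl, h⟩ | ⟨T, rfl, h⟩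
        · exact Or.inr ⟨[], by simp, by simpa using h.symm⟩
        · exact Or.inl ⟨T, rfl⟩
      · exact Or.inr ⟨U, rfl, hU⟩
    rcases key with ⟨U, rfl⟩ | ⟨U, rfl, hU⟩
    · obtain ⟨q, hq, hn⟩ := hred P Q U a e hS
      exact hn (hQ q hq)
    cases n with
    | zero => simp [wordPow] at hU
    | succ n =>
      rw [wordPow, List.append_eq_append_iff] at hU
      -- The partner lies in the second copy of `W`: otherwise the word in between contains a full
      -- copy, hence the letter `(a, e)`, and `a` is not adjacent to itself.
      have key : ∃ R', W = U ++ (a, !e) :: R' := by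
        rcases hU with ⟨S, rfl, -⟩ | ⟨S, hS', hU⟩
        · exact absurd (hQ (a, e) (by simp [hS])) Γ.irrefl
        · rcases List.cons_eq_append_iff.mp hU with ⟨rfl, -⟩ | ⟨R', rfl, -⟩
          · refine absurd (hQ (a, e) ?_) Γ.irrefl
            have : (a, e) ∈ W := by simp [hS]
            rw [hS'] at this
            simpa using Or.inr this
          · exact ⟨R', hS'⟩
      obtain ⟨R', hR'⟩ := key
      obtain ⟨M, k, hM, hlt⟩ := exists_shorter_conj hS hR'
        (fun q hq => hQ q (by simp [hq])) (fun q hq => hQ q (by simp [hq]))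
      have := hW M k hM
      omega

/-- Every element is conjugate to one spelled by a word all of whose powers are reduced. -/
lemma exists_cyclically_reduced (g : RAAG Γ) :
    ∃ (W : List (V × Bool)) (k : RAAG Γ), wordProd Γ W = k⁻¹ * g * k ∧
      ∀ n, IsReducedWord Γ (wordPow W n) := by
  classical
  have hex : ∃ n, ∃ (W : List (V × Bool)) (k : RAAG Γ),
      wordProd Γ W = k⁻¹ * g * k ∧ W.length = n := by
    obtain ⟨W, hW⟩ := wordProd_surjective Γ g
    exact ⟨_, W, 1, by simp [hW], rfl⟩
  obtain ⟨W, k, hWk, hlen⟩ := Nat.find_spec hex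
  refine ⟨W, k, hWk, isReducedWord_wordPow fun M j hM => ?_⟩
  rw [hlen]
  exact Nat.find_min' hex ⟨M, k * j, by rw [hM, hWk]; group, rfl⟩

end Words

end ExtensionGraph

namespace ExtensionGraph

/-! ### An action on states that follows a reduced word. -/

section Representation

variable {V : Type*} [DecidableEq V]

/-- The number of occurrences of a vertex, with either sign, in a word. -/
def vcount (u : V) (L : List (V × Bool)) : ℕ := L.countP fun l => l.1 = u

@[simp] lemma vcount_nil (u : V) : vcount u [] = 0 := rfl

@[simp] lemma vcount_append (u : V) (L M : List (V × Bool)) :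
    vcount u (L ++ M) = vcount u L + vcount u M := by
  simp [vcount]

lemma vcount_cons_self (a : V) (e : Bool) (L : List (V × Bool)) :
    vcount a ((a, e) :: L) = vcount a L + 1 := by
  simp [vcount]

lemma vcount_cons_of_ne {a u : V} (h : u ≠ a) (e : Bool) (L : List (V × Bool)) :
    vcount u ((a, e) :: L) = vcount u L := by
  simp [vcount, h.symm]

lemma vcount_pos {u : V} {L : List (V × Bool)} : 0 < vcount u L ↔ ∃ e, (u, e) ∈ L := by
  simp [vcount, List.countP_pos_iff]

lemma vcount_le_of_suffix {D E : List (V × Bool)} (h : D <:+ E) (u : V) :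
    vcount u D ≤ vcount u E :=
  h.sublist.countP_le

lemma vcount_le_length (u : V) (L : List (V × Bool)) : vcount u L ≤ L.length :=
  List.countP_le_length

lemma suffix_of_vcount_lt {L D E : List (V × Bool)} (hD : D <:+ L) (hE : E <:+ L) {a : V}
    (h : vcount a D < vcount a E) : D <:+ E := by
  rcases List.suffix_or_suffix_of_suffix hD hE with h' | h'
  · exact h'
  · have := vcount_le_of_suffix h' a
    omega

variable (Γ : SimpleGraph V) (L : List (V × Bool))

/-- The values of the coordinate `a` for which `c` is compatible, for every vertex `w` not
commuting with `a`, with the numbers of occurrences of `a` and `w` in some suffix of `L`. -/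
def admissible (a : V) (c : V → ℕ) : Set ℕ :=
  {x | x ≤ L.length ∧ ∀ w, w ≠ a → ¬ Γ.Adj a w → ∃ D, D <:+ L ∧ vcount a D = x ∧ vcount w D = c w}

/-- The word `L` prescribes that the generator `a` moves the coordinate `a` from `x` to `y`. -/
def Step (a : V) (x y : ℕ) : Prop :=
  (∃ D, (a, true) :: D <:+ L ∧ vcount a D = x ∧ y = x + 1) ∨
    ∃ D, (a, false) :: D <:+ L ∧ vcount a D = y ∧ x = y + 1

variable {Γ L}

/-- Consecutive occurrences of `a` with opposite signs are separated in a reduced word by some `w`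
not commuting with `a`. A suffix with the lower count of `a` ends before this `w` and one with the
count two higher includes it, so they cannot both contain `c w` letters `w`. -/
lemma sign_eq_of_admissible (hL : IsReducedWord Γ L) {a : V} {c : V → ℕ} {D E : List (V × Bool)}
    {e f : Bool} (hD : (a, e) :: D <:+ L) (hE : (a, f) :: E <:+ L)
    (h : vcount a E = vcount a D + 1) (h₀ : vcount a D ∈ admissible Γ L a c)
    (h₂ : vcount a D + 2 ∈ admissible Γ L a c) : e = f := by
  by_contra hne
  have hef : e = !f := by cases e <;> cases f <;> simp_all
  have hE' : E <:+ L := (List.suffix_cons _ _).trans hE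
  have hDE : (a, e) :: D <:+ E := by
    have h' : (a, e) :: D <:+ (a, f) :: E :=
      suffix_of_vcount_lt hD hE (a := a) (by simp only [vcount_cons_self]; omega)
    rcases List.suffix_cons_iff.mp h' with h' | h'
    · simp_all
    · exact h'
  obtain ⟨Q, rfl⟩ := hDE
  obtain ⟨P, hP⟩ := hE
  obtain ⟨⟨w, b⟩, hq, hadj⟩ := hL P Q D a f (by rw [← hP, hef])
  rw [vcount_append, vcount_cons_self] at h
  have hwa : w ≠ a := by
    rintro rfl
    have := vcount_pos.mpr ⟨b, hq⟩
    omega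
  have hw : 0 < vcount w Q := vcount_pos.mpr ⟨b, hq⟩
  obtain ⟨F, hF, hFa, hFw⟩ := h₀.2 w hwa hadj
  obtain ⟨G, hG, hGa, hGw⟩ := h₂.2 w hwa hadj
  have h1 := vcount_le_of_suffix (suffix_of_vcount_lt hF hD (a := a)
    (by rw [vcount_cons_self]; omega)) w
  have h2 := vcount_le_of_suffix (suffix_of_vcount_lt hE' hG (a := a)
    (by rw [vcount_append, vcount_cons_self]; omega)) w
  rw [vcount_cons_of_ne hwa] at h1
  rw [vcount_append, vcount_cons_of_ne hwa] at h2
  omega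

lemma Step.right_unique (hL : IsReducedWord Γ L) {a : V} {c : V → ℕ} {x y z : ℕ}
    (hy : y ∈ admissible Γ L a c) (hz : z ∈ admissible Γ L a c)
    (h : Step L a x y) (h' : Step L a x z) : y = z := by
  rcases h with ⟨D, hD, rfl, rfl⟩ | ⟨D, hD, rfl, hx⟩ <;>
    rcases h' with ⟨E, hE, hx', rfl⟩ | ⟨E, hE, rfl, hx'⟩
  · rfl
  · have := sign_eq_of_admissible hL hE hD hx' hz (by rwa [hx'] at hy)
    simp at this
  · have := sign_eq_of_admissible hL hD hE (by omega) hy (by rwa [hx] at hz)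
    simp at this
  · omega

lemma Step.left_unique (hL : IsReducedWord Γ L) {a : V} {c : V → ℕ} {x y z : ℕ}
    (hy : y ∈ admissible Γ L a c) (hz : z ∈ admissible Γ L a c)
    (h : Step L a y x) (h' : Step L a z x) : y = z := by
  rcases h with ⟨D, hD, rfl, hx⟩ | ⟨D, hD, rfl, rfl⟩ <;>
    rcases h' with ⟨E, hE, rfl, hx'⟩ | ⟨E, hE, hx', rfl⟩
  · omega
  · have := sign_eq_of_admissible hL hD hE (by omega) hy (by rwa [hx] at hz)
    simp at this
  · have := sign_eq_of_admissible hL hE hD (by omega) hz (by rwa [hx'] at hy)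
    simp at this
  · rfl

/-- A partial injection of a finite type extends to a permutation. -/
lemma exists_perm_extending {α : Type*} [Finite α] (r : α → α → Prop)
    (hr : ∀ x y z, r x y → r x z → y = z) (hl : ∀ x y z, r y x → r z x → y = z) :
    ∃ π : Equiv.Perm α, ∀ x y, r x y → π x = y := by
  classical
  let e : {x // ∃ y, r x y} ≃ {y // ∃ x, r x y} :=
    { toFun := fun x => ⟨x.2.choose, x.1, x.2.choose_spec⟩
      invFun := fun y => ⟨y.2.choose, y.1, y.2.choose_spec⟩
      left_inv := fun x => Subtype.ext (hl _ _ _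
        (Exists.choose_spec (p := fun z => r z x.2.choose) _) x.2.choose_spec)
      right_inv := fun y => Subtype.ext (hr _ _ _
        (Exists.choose_spec (p := fun z => r y.2.choose z) _) y.2.choose_spec) }
  refine ⟨e.extendSubtype, fun x y h => ?_⟩
  rw [Equiv.extendSubtype_apply_of_mem e x ⟨y, h⟩]
  exact hr x _ _ (Exists.choose_spec (p := fun z => r x z) _) h

/-- The prescribed steps form a partial injection of the admissible values. The bound by `L.length`
makes this set finite, so the injection extends to a permutation of it. -/
lemma exists_chainPerm (hL : IsReducedWord Γ L) (a : V) (c : V → ℕ) :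
    ∃ π : Equiv.Perm ℕ, (∀ x ∈ admissible Γ L a c, π x ∈ admissible Γ L a c ∧
        π.symm x ∈ admissible Γ L a c) ∧
      ∀ x ∈ admissible Γ L a c, ∀ y ∈ admissible Γ L a c, Step L a x y → π x = y := by
  classical
  have hfin : Finite (admissible Γ L a c) :=
    Set.Finite.subset (Set.finite_Iic L.length) fun x hx => hx.1
  obtain ⟨π, hπ⟩ := exists_perm_extending
    (fun x y : admissible Γ L a c => Step L a x y)
    (fun x y z h h' => Subtype.ext (Step.right_unique hL y.2 z.2 h h'))
    (fun x y z h h' => Subtype.ext (Step.left_unique hL y.2 z.2 h h'))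
  refine ⟨Equiv.Perm.ofSubtype π, fun x hx => ⟨?_, ?_⟩, fun x hx y hy h => ?_⟩
  · rw [Equiv.Perm.ofSubtype_apply_of_mem π hx]
    exact (π ⟨x, hx⟩).2
  · have : (Equiv.Perm.ofSubtype π).symm x = Equiv.Perm.ofSubtype π⁻¹ x := by
      rw [map_inv]; rfl
    rw [this, Equiv.Perm.ofSubtype_apply_of_mem _ hx]
    exact (π⁻¹ ⟨x, hx⟩).2
  · rw [Equiv.Perm.ofSubtype_apply_of_mem π hx, hπ ⟨x, hx⟩ ⟨y, hy⟩ h]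

variable (L) in
/-- A permutation of the values of the coordinate `a` that preserves the admissible values `I` and
realizes the steps that `L` prescribes between them, if there is one. -/
noncomputable def chainPerm (a : V) (I : Set ℕ) : Equiv.Perm ℕ := by
  classical
  exact if h : ∃ π : Equiv.Perm ℕ, (∀ x ∈ I, π x ∈ I ∧ π.symm x ∈ I) ∧
      ∀ x ∈ I, ∀ y ∈ I, Step L a x y → π x = y then h.choose else 1

lemma chainPerm_spec (hL : IsReducedWord Γ L) (a : V) (c : V → ℕ) :
    (∀ x ∈ admissible Γ L a c, chainPerm L a (admissible Γ L a c) x ∈ admissible Γ L a c ∧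
        (chainPerm L a (admissible Γ L a c)).symm x ∈ admissible Γ L a c) ∧
      ∀ x ∈ admissible Γ L a c, ∀ y ∈ admissible Γ L a c, Step L a x y →
        chainPerm L a (admissible Γ L a c) x = y := by
  have h := exists_chainPerm hL a c
  rw [chainPerm, dif_pos h]
  exact h.choose_spec

/-- Admissibility at `a` reads only coordinates at vertices that do not commute with `a`. This makes
`genPerm` invertible and lets adjacent generators act independently. -/
lemma admissible_update {a b : V} (h : b = a ∨ Γ.Adj a b) (c : V → ℕ) (y : ℕ) :
    admissible Γ L a (Function.update c b y) = admissible Γ L a c := by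
  ext x
  refine and_congr_right fun _ => forall_congr' fun w => forall_congr' fun hw =>
    forall_congr' fun hadj => ?_
  rw [Function.update_of_ne]
  rintro rfl
  rcases h with rfl | h
  · exact hw rfl
  · exact hadj h

variable (Γ L) in
/-- The permutation of the states by which the generator `a` acts. -/
noncomputable def genPerm (a : V) : Equiv.Perm (V → ℕ) where
  toFun c := Function.update c a (chainPerm L a (admissible Γ L a c) (c a))
  invFun c := Function.update c a ((chainPerm L a (admissible Γ L a c)).symm (c a))
  left_inv c := by simp [admissible_update]
  right_inv c := by simp [admissible_update]

lemma genPerm_apply (a : V) (c : V → ℕ) : genPerm Γ L a c =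
    Function.update c a (chainPerm L a (admissible Γ L a c) (c a)) := rfl

lemma genPerm_inv_apply (a : V) (c : V → ℕ) : (genPerm Γ L a)⁻¹ c =
    Function.update c a ((chainPerm L a (admissible Γ L a c)).symm (c a)) := rfl

lemma genPerm_commute {a b : V} (h : Γ.Adj a b) :
    genPerm Γ L a * genPerm Γ L b = genPerm Γ L b * genPerm Γ L a := by
  ext1 c
  simp only [Equiv.Perm.mul_apply, genPerm_apply]
  rw [admissible_update (Or.inr h), admissible_update (Or.inr h.symm),
    Function.update_of_ne h.ne, Function.update_of_ne h.ne', Function.update_comm h.ne']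

variable (Γ L) in
/-- The action of `A(Γ)` on states given by a word. -/
noncomputable def wordRep : RAAG Γ →* Equiv.Perm (V → ℕ) :=
  PresentedGroup.toGroup (f := genPerm Γ L) <| by
    rintro r ⟨v, w, h, rfl⟩
    simp only [map_mul, map_inv, FreeGroup.lift_apply_of]
    rw [genPerm_commute h]
    group

@[simp] lemma wordRep_gen (a : V) : wordRep Γ L (RAAG.gen Γ a) = genPerm Γ L a :=
  PresentedGroup.toGroup.of _

/-- The suffixes `D` and `(a, e) :: D` themselves witness that the counts before and after the
letter are admissible, so the permutation has to realize this step. -/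
lemma wordRep_suffix (hL : IsReducedWord Γ L) {D : List (V × Bool)} (hD : D <:+ L) :
    wordRep Γ L (wordProd Γ D) 0 = fun u => vcount u D := by
  induction D with
  | nil => ext; simp
  | cons l D ih =>
    obtain ⟨a, e⟩ := l
    have hD' : D <:+ L := (List.suffix_cons _ _).trans hD
    have h0 : vcount a D ∈ admissible Γ L a fun u => vcount u D :=
      ⟨(vcount_le_length _ _).trans hD'.length_le, fun w hw _ => ⟨D, hD', rfl, rfl⟩⟩
    have h1 : vcount a D + 1 ∈ admissible Γ L a fun u => vcount u D :=
      ⟨by rw [← vcount_cons_self a e]; exact (vcount_le_length _ _).trans hD.length_le,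
        fun w hw _ => ⟨_, hD, vcount_cons_self _ _ _, vcount_cons_of_ne hw _ _⟩⟩
    have hup : (fun u => vcount u ((a, e) :: D)) =
        Function.update (fun u => vcount u D) a (vcount a D + 1) := by
      ext u
      by_cases h : u = a
      · subst h; simp [vcount_cons_self]
      · simp [h, vcount_cons_of_ne h]
    have hs := (chainPerm_spec hL a fun u => vcount u D).2
    rw [wordProd_cons, map_mul, Equiv.Perm.mul_apply, ih hD', hup]
    cases e with
    | true =>
      simp only [letter, cond_true, wordRep_gen, genPerm_apply]
      rw [hs _ h0 _ h1 (Or.inl ⟨D, hD, rfl, rfl⟩)]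
    | false =>
      simp only [letter, cond_false, map_inv, wordRep_gen, genPerm_inv_apply]
      rw [(Equiv.symm_apply_eq _).mpr (hs _ h1 _ h0 (Or.inr ⟨D, hD, rfl, rfl⟩)).symm]

lemma wordRep_letter_of_ne {u : V} {l : V × Bool} (h : l.1 ≠ u) (c : V → ℕ) :
    wordRep Γ L (letter Γ l) c u = c u := by
  obtain ⟨a, e⟩ := l
  cases e
  · simp only [letter, cond_false, map_inv, wordRep_gen, genPerm_inv_apply]
    rw [Function.update_of_ne h.symm]
  · simp only [letter, cond_true, wordRep_gen, genPerm_apply]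
    rw [Function.update_of_ne h.symm]

variable (Γ L) in
/-- A state is valid if any two coordinates at non-commuting vertices are the numbers of
occurrences of these vertices in a suffix of `L`. -/
def IsValidState (c : V → ℕ) : Prop := ∀ a, c a ∈ admissible Γ L a c

lemma IsValidState.update {c : V → ℕ} (hc : IsValidState Γ L c) {a : V} {x : ℕ}
    (hx : x ∈ admissible Γ L a c) : IsValidState Γ L (Function.update c a x) := by
  intro b
  by_cases hb : b = a
  · subst hb
    rw [admissible_update (Or.inl rfl), Function.update_self]
    exact hx
  rw [Function.update_of_ne hb]
  refine ⟨(hc b).1, fun w hw hadj => ?_⟩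
  by_cases hwa : w = a
  · subst hwa
    obtain ⟨D, hD, h1, h2⟩ := hx.2 b hb fun h => hadj h.symm
    exact ⟨D, hD, h2, by simpa using h1⟩
  · rw [Function.update_of_ne hwa]
    exact (hc b).2 w hw hadj

/-- The empty suffix makes the zero state valid, and each `chainPerm` and its inverse preserve the
admissible values. -/
lemma isValidState_wordRep (hL : IsReducedWord Γ L) (g : RAAG Γ) :
    IsValidState Γ L (wordRep Γ L g 0) := by
  obtain ⟨W, rfl⟩ := wordProd_surjective Γ g
  induction W with
  | nil =>
    simp only [wordProd_nil, map_one, Equiv.Perm.one_apply]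
    exact fun a => ⟨by simp, fun w _ _ => ⟨[], List.nil_suffix, rfl, rfl⟩⟩
  | cons l W ih =>
    obtain ⟨a, e⟩ := l
    rw [wordProd_cons, map_mul, Equiv.Perm.mul_apply]
    have hs := (chainPerm_spec hL a (wordRep Γ L (wordProd Γ W) 0)).1 _ (ih a)
    cases e
    · simp only [letter, cond_false, map_inv, wordRep_gen, genPerm_inv_apply]
      exact ih.update hs.2
    · simp only [letter, cond_true, wordRep_gen, genPerm_apply]
      exact ih.update hs.1

end Representation

end ExtensionGraph

namespace ExtensionGraph

/-! ### Centralizers of vertices and edges of the extension graph. -/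

section Centralizers

variable {V : Type*} {Γ : SimpleGraph V}

/-- The closed star of a vertex. -/
def closedStar (Γ : SimpleGraph V) (w : V) : Set V := {u | u = w ∨ Γ.Adj w u}

variable (Γ) in
/-- The subgroup generated by a set of vertices. -/
def spanSubgroup (A : Set V) : Subgroup (RAAG Γ) := Subgroup.closure (RAAG.gen Γ '' A)

lemma letter_mem_spanSubgroup {A : Set V} {l : V × Bool} (h : l.1 ∈ A) :
    letter Γ l ∈ spanSubgroup Γ A := by
  have : RAAG.gen Γ l.1 ∈ spanSubgroup Γ A := Subgroup.subset_closure ⟨_, h, rfl⟩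
  obtain ⟨a, e⟩ := l
  cases e
  · exact inv_mem this
  · exact this

lemma wordProd_mem_spanSubgroup {A : Set V} {L : List (V × Bool)} (h : ∀ l ∈ L, l.1 ∈ A) :
    wordProd Γ L ∈ spanSubgroup Γ A :=
  Subgroup.list_prod_mem _ fun x hx => by
    obtain ⟨l, hl, rfl⟩ := List.mem_map.mp hx
    exact letter_mem_spanSubgroup (h l hl)

lemma commute_gen_of_mem_star {w : V} {s : RAAG Γ} (h : s ∈ spanSubgroup Γ (closedStar Γ w)) :
    Commute s (RAAG.gen Γ w) := by
  induction h using Subgroup.closure_induction with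
  | mem x hx =>
    obtain ⟨u, rfl | hu, rfl⟩ := hx
    · exact Commute.refl _
    · exact (gen_commute hu).symm
  | one => exact Commute.one_left _
  | mul x y _ _ hx hy => exact hx.mul_left hy
  | inv x _ hx => exact hx.inv_left

lemma wordRep_apply_of_mem_spanSubgroup [DecidableEq V] {L : List (V × Bool)} {A : Set V}
    {s : RAAG Γ} (hs : s ∈ spanSubgroup Γ A) {u : V} (hu : u ∉ A) (c : V → ℕ) :
    wordRep Γ L s c u = c u := by
  induction hs using Subgroup.closure_induction generalizing c with
  | mem x hx =>
    obtain ⟨a, ha, rfl⟩ := hx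
    exact wordRep_letter_of_ne (l := (a, true)) (by rintro rfl; exact hu ha) c
  | one => simp
  | mul x y _ _ hx hy => rw [map_mul, Equiv.Perm.mul_apply, hx, hy]
  | inv x _ hx =>
    have := hx (wordRep Γ L x⁻¹ c)
    rw [← Equiv.Perm.mul_apply, ← map_mul] at this
    simpa using this.symm

lemma invRev_append (L M : List (V × Bool)) :
    FreeGroup.invRev (L ++ M) = FreeGroup.invRev M ++ FreeGroup.invRev L := by
  simp [FreeGroup.invRev]

lemma invRev_cons (l : V × Bool) (M : List (V × Bool)) :
    FreeGroup.invRev (l :: M) = FreeGroup.invRev M ++ [(l.1, !l.2)] := by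
  simp [FreeGroup.invRev]

lemma mem_invRev {l : V × Bool} {L : List (V × Bool)} (h : l ∈ FreeGroup.invRev L) :
    (l.1, !l.2) ∈ L := by
  simp only [FreeGroup.invRev, List.mem_reverse, List.mem_map] at h
  obtain ⟨m, hm, rfl⟩ := h
  simpa using hm

/-- If `W` is a shortest word in its coset of the star subgroup of `w`, then `W w W⁻¹` is
reduced. -/
lemma isReducedWord_conj {w : V} {W : List (V × Bool)}
    (hW : ∀ (M : List (V × Bool)), ∀ s ∈ spanSubgroup Γ (closedStar Γ w),
      wordProd Γ M = wordProd Γ W * s → W.length ≤ M.length) :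
    IsReducedWord Γ (W ++ (w, true) :: FreeGroup.invRev W) := by
  have hred : IsReducedWord Γ W := by
    by_contra h
    obtain ⟨M, hlt, hM⟩ := exists_shorter_of_not_isReducedWord h
    have := hW M 1 (one_mem _) (by simp [hM])
    omega
  have hredinv : IsReducedWord Γ (FreeGroup.invRev W) := by
    by_contra h
    obtain ⟨M, hlt, hM⟩ := exists_shorter_of_not_isReducedWord h
    have := hW (FreeGroup.invRev M) 1 (one_mem _) (by
      rw [wordProd_invRev, hM, wordProd_invRev]; simp)
    simp only [FreeGroup.invRev_length] at this hlt
    omega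
  -- A letter of the star that commutes to the end of `W` could be absorbed into the coset,
  -- shortening `W`.
  have strip : ∀ P T a e, W = P ++ (a, e) :: T → (∀ q ∈ T, Γ.Adj a q.1) →
      a ∉ closedStar Γ w := by
    intro P T a e h hT ha
    have hc : Commute (letter Γ (a, e)) (wordProd Γ T) :=
      letter_commute_wordProd fun q hq => Or.inl (hT q hq)
    have := hW (P ++ T) (letter Γ (a, e))⁻¹ (inv_mem (letter_mem_spanSubgroup ha)) (by
      rw [h]; simp only [wordProd_append, wordProd_cons]; rw [hc.eq]; group)
    rw [h] at this
    simp at this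
  have stripInv : ∀ Q R e, FreeGroup.invRev W = Q ++ (w, e) :: R → (∀ q ∈ Q, Γ.Adj w q.1) →
      False := by
    intro Q R e h hQ
    have h' := congrArg FreeGroup.invRev h
    rw [FreeGroup.invRev_invRev, invRev_append, invRev_cons, List.append_assoc] at h'
    exact strip _ _ _ _ h' (fun q hq => by simpa using hQ _ (mem_invRev hq)) (Or.inl rfl)
  intro P Q R a e h
  by_contra! hQ
  rcases List.append_eq_append_iff.mp h with ⟨S, rfl, hS⟩ | ⟨S, rfl, hS⟩
  · rcases List.cons_eq_append_iff.mp hS with ⟨rfl, h'⟩ | ⟨S', rfl, h'⟩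
    · simp only [List.cons.injEq, Prod.mk.injEq] at h'
      obtain ⟨⟨rfl, rfl⟩, h''⟩ := h'
      exact stripInv _ _ _ h''.symm hQ
    · obtain ⟨q, hq, hn⟩ := hredinv S' Q R a e h'
      exact hn (hQ q hq)
  · rcases List.cons_eq_append_iff.mp hS with ⟨rfl, h'⟩ | ⟨T, rfl, h'⟩
    · simp only [List.cons.injEq, Prod.mk.injEq] at h'
      obtain ⟨⟨rfl, rfl⟩, h''⟩ := h'
      exact stripInv _ _ _ h'' hQ
    · rcases List.append_eq_append_iff.mp h' with ⟨U, rfl, hU⟩ | ⟨U, rfl, hU⟩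
      · rcases List.cons_eq_append_iff.mp hU with ⟨rfl, h'⟩ | ⟨T', rfl, h'⟩
        · simp only [List.cons.injEq, Prod.mk.injEq] at h'
          exact strip P _ a e rfl (fun q hq => hQ q (by simpa using hq)) (Or.inl h'.1.1.symm)
        · obtain ⟨q, hq, hn⟩ := hred P Q T' a e rfl
          exact hn (hQ q hq)
      -- The pair straddles the central `w`: either `a = w`, or `a` has to pass `w` and is adjacent
      -- to it.
      · refine strip P T a e rfl (fun q hq => hQ q (by simp [hq])) ?_
        rcases List.cons_eq_append_iff.mp hU with ⟨rfl, hw⟩ | ⟨T', rfl, -⟩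
        · simp only [List.cons.injEq, Prod.mk.injEq] at hw
          exact Or.inl hw.1.1
        · exact Or.inr (hQ (w, true) (by simp)).symm

/-- The centralizer of a vertex is generated by its star. -/
lemma mem_star_of_commute {w : V} {g : RAAG Γ} (hg : Commute g (RAAG.gen Γ w)) :
    g ∈ spanSubgroup Γ (closedStar Γ w) := by
  classical
  have hex : ∃ n, ∃ (W : List (V × Bool)), ∃ s ∈ spanSubgroup Γ (closedStar Γ w),
      wordProd Γ W = g * s ∧ W.length = n := by
    obtain ⟨W, hW⟩ := wordProd_surjective Γ g
    exact ⟨_, W, 1, one_mem _, by simp [hW], rfl⟩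
  obtain ⟨W, s, hs, hWs, hlen⟩ := Nat.find_spec hex
  have hred : IsReducedWord Γ (W ++ (w, true) :: FreeGroup.invRev W) := by
    refine isReducedWord_conj fun M t ht hM => ?_
    rw [hlen]
    exact Nat.find_min' hex ⟨M, s * t, mul_mem hs ht, by rw [hM, hWs, mul_assoc], rfl⟩
  have hcomm : Commute (wordProd Γ W) (RAAG.gen Γ w) := by
    rw [hWs]
    exact hg.mul_left (commute_gen_of_mem_star hs)
  have hprod : wordProd Γ (W ++ (w, true) :: FreeGroup.invRev W) = letter Γ (w, true) := by
    rw [wordProd_append, wordProd_cons, wordProd_invRev, ← mul_assoc]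
    change wordProd Γ W * RAAG.gen Γ w * _ = RAAG.gen Γ w
    rw [hcomm.eq]
    group
  -- The reduced word `W w W⁻¹` represents `w`, which moves only coordinate `w`; yet that action
  -- counts every letter of the word. So no letter of `W` lies off the star.
  have hrep := wordRep_suffix hred (List.suffix_refl _)
  rw [hprod] at hrep
  have hWw : ∀ l ∈ W, l.1 ∈ closedStar Γ w := by
    rintro ⟨u, e⟩ hl
    by_contra hu
    have h1 := congrFun hrep u
    rw [wordRep_letter_of_ne (fun h => hu (Or.inl h.symm))] at h1
    have := vcount_pos.mpr ⟨e, hl⟩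
    simp only [Pi.zero_apply, vcount_append] at h1
    omega
  have := mul_mem (wordProd_mem_spanSubgroup hWw) (inv_mem hs)
  rwa [hWs, mul_inv_cancel_right] at this

open Classical in
variable (Γ) in
/-- The exponent sum of a vertex. -/
noncomputable def exponentSum (u : V) : RAAG Γ →* Multiplicative ℤ :=
  PresentedGroup.toGroup (f := fun v => Multiplicative.ofAdd (if v = u then 1 else 0)) <| by
    rintro r ⟨v, w, -, rfl⟩
    simp only [map_mul, map_inv]
    rw [mul_comm (FreeGroup.lift _ (FreeGroup.of v))]
    group

open Classical in
lemma exponentSum_gen (u v : V) :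
    exponentSum Γ u (RAAG.gen Γ v) = Multiplicative.ofAdd (if v = u then 1 else 0) :=
  PresentedGroup.toGroup.of _

lemma gen_ne_one (v : V) : RAAG.gen Γ v ≠ 1 := fun h => by
  have := congrArg (exponentSum Γ v) h
  rw [exponentSum_gen, map_one, if_pos rfl] at this
  exact absurd this (by decide)

lemma eq_of_conj_gen_eq {v w : V} {g h : RAAG Γ}
    (H : g⁻¹ * RAAG.gen Γ v * g = h⁻¹ * RAAG.gen Γ w * h) : v = w := by
  have := congrArg (exponentSum Γ v) H
  simp only [map_mul, map_inv, exponentSum_gen, inv_mul_cancel_comm, if_pos] at this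
  by_contra hne
  rw [if_neg (fun h => hne h.symm)] at this
  exact absurd this (by decide)

open Classical in
variable (Γ) in
/-- The retraction of `A(Γ)` to the subgroup generated by `A`. -/
noncomputable def retraction (A : Set V) : RAAG Γ →* RAAG Γ :=
  PresentedGroup.toGroup (f := fun v => if v ∈ A then RAAG.gen Γ v else 1) <| by
    rintro r ⟨v, w, h, rfl⟩
    simp only [map_mul, map_inv, FreeGroup.lift_apply_of]
    have := (gen_commute h).eq
    split_ifs <;> simp [this]

open Classical in
lemma retraction_gen (A : Set V) (v : V) :
    retraction Γ A (RAAG.gen Γ v) = if v ∈ A then RAAG.gen Γ v else 1 :=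
  PresentedGroup.toGroup.of _

lemma retraction_mem (A : Set V) (g : RAAG Γ) : retraction Γ A g ∈ spanSubgroup Γ A := by
  obtain ⟨W, rfl⟩ := wordProd_surjective Γ g
  induction W with
  | nil => simp
  | cons l W ih =>
    rw [wordProd_cons, map_mul]
    refine mul_mem ?_ ih
    have : retraction Γ A (RAAG.gen Γ l.1) ∈ spanSubgroup Γ A := by
      rw [retraction_gen]
      split_ifs with h
      · exact Subgroup.subset_closure ⟨_, h, rfl⟩
      · exact one_mem _
    obtain ⟨a, e⟩ := l
    cases e
    · simpa [letter] using this
    · exact this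

lemma retraction_eq_self {A : Set V} {g : RAAG Γ} (hg : g ∈ spanSubgroup Γ A) :
    retraction Γ A g = g := by
  induction hg using Subgroup.closure_induction with
  | mem x hx =>
    obtain ⟨u, hu, rfl⟩ := hx
    rw [retraction_gen, if_pos hu]
  | one => simp
  | mul x y _ _ hx hy => rw [map_mul, hx, hy]
  | inv x _ hx => rw [map_inv, hx]

/-- Commuting distinct conjugates of vertices are simultaneously conjugate to adjacent vertices. -/
lemma exists_common_conjugator {v w : V} {h k : RAAG Γ}
    (hne : h⁻¹ * RAAG.gen Γ v * h ≠ k⁻¹ * RAAG.gen Γ w * k)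
    (hc : Commute (h⁻¹ * RAAG.gen Γ v * h) (k⁻¹ * RAAG.gen Γ w * k)) :
    Γ.Adj v w ∧ ∃ m, m * h⁻¹ ∈ spanSubgroup Γ (closedStar Γ v) ∧
      m * k⁻¹ ∈ spanSubgroup Γ (closedStar Γ w) := by
  set n := h * k⁻¹ with hn
  have hc' : Commute (n⁻¹ * RAAG.gen Γ v * n) (RAAG.gen Γ w) := by
    have := congrArg (fun z => k * z * k⁻¹) hc.eq
    simp only [Commute, SemiconjBy, hn]
    convert this using 1 <;> group
  have hmem := mem_star_of_commute hc'
  have hr := retraction_eq_self hmem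
  -- The retraction onto the star subgroup fixes `v^n`; if it killed `v` then `v` would be trivial.
  have hvw : v ∈ closedStar Γ w := by
    by_contra hv
    rw [map_mul, map_mul, retraction_gen, if_neg hv, map_inv, mul_one, inv_mul_cancel] at hr
    refine gen_ne_one (Γ := Γ) v ?_
    calc RAAG.gen Γ v = n * (n⁻¹ * RAAG.gen Γ v * n) * n⁻¹ := by group
      _ = 1 := by rw [← hr]; group
  -- Now `v^n = v^ρ` with `ρ` in the star subgroup of `w`, so `ρ n⁻¹` centralizes `v` and `ρ k` is
  -- the common conjugator.
  set ρ := retraction Γ (closedStar Γ w) n with hρ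
  rw [map_mul, map_mul, retraction_gen, if_pos hvw, map_inv, ← hρ] at hr
  have hcv : Commute (ρ * n⁻¹) (RAAG.gen Γ v) := by
    simp only [Commute, SemiconjBy]
    calc ρ * n⁻¹ * RAAG.gen Γ v = ρ * (n⁻¹ * RAAG.gen Γ v * n) * n⁻¹ := by group
      _ = ρ * (ρ⁻¹ * RAAG.gen Γ v * ρ) * n⁻¹ := by rw [hr]
      _ = _ := by group
  have h1 : ρ * k * h⁻¹ ∈ spanSubgroup Γ (closedStar Γ v) := by
    have := mem_star_of_commute hcv
    rwa [hn, mul_inv_rev, inv_inv, ← mul_assoc] at this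
  have h2 : ρ * k * k⁻¹ ∈ spanSubgroup Γ (closedStar Γ w) := by
    rw [mul_inv_cancel_right]
    exact retraction_mem _ _
  refine ⟨?_, ρ * k, h1, h2⟩
  rcases hvw with rfl | hadj
  · refine absurd ?_ hne
    have e : n⁻¹ * RAAG.gen Γ v * n = RAAG.gen Γ v := by
      rw [← hr, mul_assoc, ← (commute_gen_of_mem_star (retraction_mem (closedStar Γ v) n)).eq, ← hρ]
      group
    calc h⁻¹ * RAAG.gen Γ v * h = k⁻¹ * (n⁻¹ * RAAG.gen Γ v * n) * k := by rw [hn]; group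
      _ = _ := by rw [e]
  · exact hadj.symm

end Centralizers

end ExtensionGraph

namespace ExtensionGraph

/-! ### Levels and the distance estimate. -/

section LowerBound

variable {V : Type*} {Γ : SimpleGraph V}

variable (Γ) in
/-- The complement graph is connected on `S`: any proper nonempty part of `S` has a vertex that
does not commute with some vertex of the rest. -/
def IsCoconnected (S : Set V) : Prop :=
  ∀ A : Set V, (∃ u ∈ S, u ∈ A) → (∃ w ∈ S, w ∉ A) →
    ∃ u ∈ S, ∃ w ∈ S, u ∈ A ∧ w ∉ A ∧ ¬ Γ.Adj u w

/-- A function on `S` that changes by at most one along edges of the complement graph exceeds its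
values off the star of a vertex by at most `|V| - 2`. -/
lemma le_add_card_sub_two [Fintype V] (hcard : 3 ≤ Fintype.card V) {S : Set V}
    (hS : IsCoconnected Γ S) {v t : V} (htS : t ∈ S) (ht : t ∉ closedStar Γ v) {M : V → ℕ} {j : ℕ}
    (hM : ∀ u ∈ S, ∀ w ∈ S, u ≠ w → ¬ Γ.Adj u w → M u ≤ M w + 1)
    (hj : ∀ u ∈ S, u ∉ closedStar Γ v → M u ≤ j) {u : V} (hu : u ∈ S) :
    M u ≤ j + (Fintype.card V - 2) := by
  by_contra! hlt
  -- By a discrete intermediate value argument all levels `j + 1, …, j + |V| - 1` occur. Together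
  -- with `t` at index `0` they exhaust `V`, one vertex per level.
  have hex : ∀ i : Fin (Fintype.card V), ∃ x ∈ S,
      (i.1 = 0 → x = t) ∧ (i.1 ≠ 0 → M x = j + i.1) := by
    intro i
    by_cases hi : i.1 = 0
    · exact ⟨t, htS, fun _ => rfl, fun h => absurd hi h⟩
    · have hi' := i.2
      obtain ⟨x, hx, y, hy, hxA, hyA, hadj⟩ := hS {x | j + i.1 ≤ M x}
        ⟨u, hu, by simp only [Set.mem_ofPred_eq]; omega⟩
        ⟨t, htS, by have := hj t htS ht; simp only [Set.mem_ofPred_eq]; omega⟩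
      simp only [Set.mem_ofPred_eq] at hxA hyA
      have := hM x hx y hy (by rintro rfl; exact hyA hxA) hadj
      exact ⟨x, hx, fun h => absurd h hi, fun _ => by omega⟩
  choose f hfS hf0 hf using hex
  have hMt := hj t htS ht
  have hinj : Function.Injective f := by
    intro i k hik
    have h1 := hf i
    have h2 := hf k
    have h3 := hf0 i
    have h4 := hf0 k
    rw [← hik] at h2 h4
    refine Fin.ext ?_
    by_cases hi : i.1 = 0 <;> by_cases hk : k.1 = 0
    · omega
    · have := h2 hk; rw [h3 hi] at this; omega
    · have := h1 hi; rw [h4 hk] at this; omega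
    · have := h1 hi; have := h2 hk; omega
  have hsurj : Function.Surjective f :=
    ((Fintype.bijective_iff_injective_and_card f).mpr ⟨hinj, by simp⟩).2
  have hall : ∀ x, x ∈ S := fun x => by
    obtain ⟨i, rfl⟩ := hsurj x
    exact hfS i
  have hlow : ∀ x, M x ≤ j → x = t := by
    intro x hx
    obtain ⟨i, rfl⟩ := hsurj x
    by_cases hi : i.1 = 0
    · exact hf0 i hi
    · have := hf i hi; omega
  have huniq : ∀ x y, M x = j + 1 → M y = j + 1 → x = y := by
    have key : ∀ x, M x = j + 1 → ∃ i : Fin (Fintype.card V), i.1 = 1 ∧ f i = x := by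
      intro x hx
      obtain ⟨i, rfl⟩ := hsurj x
      by_cases hi : i.1 = 0
      · have := hf0 i hi; rw [this] at hx; omega
      · have := hf i hi; exact ⟨i, by omega, rfl⟩
    intro x y hx hy
    obtain ⟨i, hi, rfl⟩ := key x hx
    obtain ⟨k, hk, rfl⟩ := key y hy
    exact congrArg f (Fin.ext (hi.trans hk.symm))
  have hnon : ∀ x, x ∉ closedStar Γ v → x = t := fun x hx => hlow x (hj x (hall x) hx)
  have hvt : v ≠ t := by
    rintro rfl
    exact ht (Or.inl rfl)
  have hMv : M v = j + 1 := by
    have h1 := hM v (hall v) t htS hvt fun h => ht (Or.inr h)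
    have h2 : ¬ M v ≤ j := fun h => hvt (hlow v h)
    omega
  -- The lower end of a complement edge leaving the levels `≥ j + 2` must be `v`, the only vertex at
  -- level `j + 1`. The upper end is then off the star of `v`, hence has level at most `j`.
  obtain ⟨x, -, y, -, hx, hy, hadj⟩ := hS {x | j + 2 ≤ M x}
    ⟨u, hu, by simp only [Set.mem_ofPred_eq]; omega⟩
    ⟨t, htS, by simp only [Set.mem_ofPred_eq]; omega⟩
  simp only [Set.mem_ofPred_eq] at hx hy
  have hxy := hM x (hall x) y (hall y) (by rintro rfl; exact hy hx) hadj
  have hyv : y = v := huniq y v (by omega) hMv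
  subst hyv
  have : x = t := hnon x (by
    rintro (rfl | h)
    · omega
    · exact hadj h.symm)
  rw [this] at hx
  omega

lemma exists_of_suffix_wordPow {W D : List (V × Bool)} {n : ℕ} (h : D <:+ wordPow W n) :
    ∃ P k, P <:+ W ∧ D = P ++ wordPow W k := by
  induction n with
  | zero => exact ⟨[], 0, List.nil_suffix, by simpa [wordPow] using h⟩
  | succ n ih =>
    obtain ⟨T, hT⟩ := h
    rw [wordPow] at hT
    rcases List.append_eq_append_iff.mp hT with ⟨A, hA, rfl⟩ | ⟨A, rfl, hA⟩
    · exact ⟨A, n, ⟨T, hA.symm⟩, rfl⟩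
    · exact ih ⟨A, hA.symm⟩

/-- The vertex `v^h` of the extension graph. -/
def ExtVertex.mk (v : V) (h : RAAG Γ) : ExtVertex Γ := ⟨h⁻¹ * RAAG.gen Γ v * h, v, h, rfl⟩

variable [DecidableEq V]

lemma vcount_wordPow (W : List (V × Bool)) (n : ℕ) (u : V) :
    vcount u (wordPow W n) = n * vcount u W := by
  induction n with
  | zero => simp [wordPow]
  | succ n ih => rw [wordPow, vcount_append, ih]; ring

/-- The number of copies of `W` that a state enters at the vertex `u`. -/
def level (W : List (V × Bool)) (c : V → ℕ) (u : V) : ℕ :=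
  (c u + vcount u W - 1) / vcount u W

/-- Rounding up puts the count in `P ++ wordPow W k`, with `P` a suffix of `W`, at level `k` if `P`
avoids `u` and at `k + 1` otherwise. -/
lemma level_bounds {W : List (V × Bool)} {c : V → ℕ} {u : V} (hu : 0 < vcount u W) {p k : ℕ}
    (hp : p ≤ vcount u W) (hc : c u = p + k * vcount u W) :
    k ≤ level W c u ∧ level W c u ≤ k + 1 := by
  rw [level]
  constructor
  · rw [Nat.le_div_iff_mul_le hu]; omega
  · rw [← Nat.lt_succ_iff, Nat.div_lt_iff_lt_mul hu, Nat.succ_mul, Nat.succ_mul]; omega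

lemma level_of_eq_mul {W : List (V × Bool)} {c : V → ℕ} {u : V} (hu : 0 < vcount u W) {n : ℕ}
    (hc : c u = n * vcount u W) : level W c u = n := by
  rw [level, hc]
  refine Nat.div_eq_of_lt_le ?_ ?_
  · omega
  · rw [Nat.succ_mul]; omega

lemma level_le_level_add_one {W : List (V × Bool)} {n : ℕ} {c : V → ℕ}
    (hc : IsValidState Γ (wordPow W n) c) {u w : V} (hu : 0 < vcount u W) (hw : 0 < vcount w W)
    (hne : u ≠ w) (hadj : ¬ Γ.Adj u w) : level W c u ≤ level W c w + 1 := by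
  obtain ⟨D, hD, h1, h2⟩ := (hc u).2 w hne.symm hadj
  obtain ⟨P, k, hP, rfl⟩ := exists_of_suffix_wordPow hD
  rw [vcount_append, vcount_wordPow] at h1 h2
  have := (level_bounds hu (vcount_le_of_suffix hP u) h1.symm).2
  have := (level_bounds hw (vcount_le_of_suffix hP w) h2.symm).1
  omega

variable (Γ) in
/-- The vertex `x = v^h` of the extension graph has level at most `j` at all vertices of `W` off
the star of `v`. -/
def LevelLE (W : List (V × Bool)) (n : ℕ) (x : ExtVertex Γ) (j : ℕ) : Prop :=
  ∀ v h, x.1 = h⁻¹ * RAAG.gen Γ v * h → ∀ u, 0 < vcount u W → u ∉ closedStar Γ v →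
    level W (wordRep Γ (wordPow W n) h 0) u ≤ j

/-- The factor `m * h⁻¹` acts last and moves only coordinates in the star. -/
lemma wordRep_mul_star {L : List (V × Bool)} {v u : V} {m h : RAAG Γ}
    (hm : m * h⁻¹ ∈ spanSubgroup Γ (closedStar Γ v)) (hu : u ∉ closedStar Γ v) (c : V → ℕ) :
    wordRep Γ L m c u = wordRep Γ L h c u := by
  have : m = m * h⁻¹ * h := by group
  rw [this, map_mul, Equiv.Perm.mul_apply, wordRep_apply_of_mem_spanSubgroup hm hu]

/-- A common conjugator `m` gives one state agreeing with that of `x` off the star of `v` and with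
that of `y` off the star of `w`. -/
lemma LevelLE.of_adj [Fintype V] (hcard : 3 ≤ Fintype.card V) {W : List (V × Bool)} {n : ℕ}
    (hW : IsReducedWord Γ (wordPow W n)) (hco : IsCoconnected Γ {u | 0 < vcount u W})
    (hstar : ∀ v, ∃ u, 0 < vcount u W ∧ u ∉ closedStar Γ v) {x y : ExtVertex Γ} {j : ℕ}
    (hx : LevelLE Γ W n x j) (hxy : (extensionGraph Γ).Adj x y) :
    LevelLE Γ W n y (j + (Fintype.card V - 2)) := by
  intro w k hy u hu huw
  obtain ⟨v, h, hxv⟩ := x.2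
  obtain ⟨hne, hc⟩ := hxy
  obtain ⟨-, m, hmv, hmw⟩ := exists_common_conjugator (Γ := Γ) (v := v) (w := w) (h := h) (k := k)
    (fun e => hne (Subtype.ext (by rw [hxv, hy, e]))) (by rw [← hxv, ← hy]; exact hc)
  have hk : level W (wordRep Γ (wordPow W n) k 0) u = level W (wordRep Γ (wordPow W n) m 0) u := by
    rw [level, level, wordRep_mul_star hmw huw]
  rw [hk]
  obtain ⟨t, ht, htv⟩ := hstar v
  refine le_add_card_sub_two hcard hco ht htv
    (fun a ha b hb hab hadj => level_le_level_add_one (isValidState_wordRep hW m) ha hb hab hadj)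
    (fun a ha hav => ?_) hu
  have : level W (wordRep Γ (wordPow W n) m 0) a = level W (wordRep Γ (wordPow W n) h 0) a := by
    rw [level, level, wordRep_mul_star hmv hav]
  rw [this]
  exact hx v h hxv a ha hav

lemma LevelLE.of_walk [Fintype V] (hcard : 3 ≤ Fintype.card V) {W : List (V × Bool)} {n : ℕ}
    (hW : IsReducedWord Γ (wordPow W n)) (hco : IsCoconnected Γ {u | 0 < vcount u W})
    (hstar : ∀ v, ∃ u, 0 < vcount u W ∧ u ∉ closedStar Γ v) {x y : ExtVertex Γ}
    (p : (extensionGraph Γ).Walk x y) {j : ℕ} (hx : LevelLE Γ W n x j) :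
    LevelLE Γ W n y (j + p.length * (Fintype.card V - 2)) := by
  induction p generalizing j with
  | nil => simpa using hx
  | cons h p ih =>
    have := ih (hx.of_adj hcard hW hco hstar h)
    rwa [SimpleGraph.Walk.length_cons, Nat.succ_mul, add_comm (_ * _), ← add_assoc]

/-- A cyclically reduced element whose support is not contained in a join moves every vertex of
`Γ` by a definite amount. -/
lemma le_dist_mul [Fintype V] (hcard : 3 ≤ Fintype.card V) {W : List (V × Bool)} {n : ℕ}
    (hW : IsReducedWord Γ (wordPow W n)) (hco : IsCoconnected Γ {u | 0 < vcount u W})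
    (hstar : ∀ v, ∃ u, 0 < vcount u W ∧ u ∉ closedStar Γ v)
    (hconn : (extensionGraph Γ).Connected) (v : V) :
    n ≤ (extensionGraph Γ).dist (ExtVertex.mk v 1 <• wordProd Γ W ^ n) (ExtVertex.mk v 1) *
      (Fintype.card V - 2) := by
  obtain ⟨p, hp⟩ := hconn.exists_walk_length_eq_dist (ExtVertex.mk v 1)
    (ExtVertex.mk (Γ := Γ) v 1 <• wordProd Γ W ^ n)
  rw [SimpleGraph.dist_comm, ← hp]
  have h0 : LevelLE Γ W n (ExtVertex.mk v 1) 0 := by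
    intro w h hx u hu huw
    have hvw : v = w := eq_of_conj_gen_eq hx
    subst hvw
    have hh : h ∈ spanSubgroup Γ (closedStar Γ v) := by
      refine mem_star_of_commute ?_
      change (1 : RAAG Γ)⁻¹ * RAAG.gen Γ v * 1 = _ at hx
      simp only [inv_one, one_mul, mul_one] at hx
      change h * RAAG.gen Γ v = RAAG.gen Γ v * h
      calc h * RAAG.gen Γ v = h * (h⁻¹ * RAAG.gen Γ v * h) := by rw [← hx]
        _ = _ := by group
    refine (level_of_eq_mul hu (n := 0) ?_).le
    rw [wordRep_apply_of_mem_spanSubgroup hh huw]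
    simp
  obtain ⟨u, hu, huv⟩ := hstar v
  have h1 := h0.of_walk hcard hW hco hstar p v (wordProd Γ W ^ n) (by
    change (wordProd Γ W ^ n)⁻¹ * ((1 : RAAG Γ)⁻¹ * RAAG.gen Γ v * 1) * wordProd Γ W ^ n = _
    simp) u hu huv
  rw [level_of_eq_mul hu (n := n), zero_add] at h1
  · exact h1
  · rw [← wordProd_wordPow, wordRep_suffix hW (List.suffix_refl _)]
    exact vcount_wordPow W n u

end LowerBound

end ExtensionGraph

namespace ExtensionGraph

/-! ### Connectedness, translation lengths and the dichotomy on supports. -/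

section Translation

variable {V : Type*} {Γ : SimpleGraph V}

lemma ExtVertex.mk_smul (v : V) (h g : RAAG Γ) :
    ExtVertex.mk v h <• g = ExtVertex.mk v (h * g) :=
  Subtype.ext (by
    change g⁻¹ * (h⁻¹ * RAAG.gen Γ v * h) * g = (h * g)⁻¹ * RAAG.gen Γ v * (h * g)
    group)

lemma ExtVertex.exists_eq_mk (x : ExtVertex Γ) : ∃ v h, x = ExtVertex.mk v h := by
  obtain ⟨v, h, hx⟩ := x.2
  exact ⟨v, h, Subtype.ext hx⟩

lemma ExtVertex.mk_mul_of_mem_star {v : V} {s : RAAG Γ}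
    (hs : s ∈ spanSubgroup Γ (closedStar Γ v)) (h : RAAG Γ) :
    ExtVertex.mk v (s * h) = ExtVertex.mk v h :=
  Subtype.ext (by
    have hc := (commute_gen_of_mem_star hs).eq
    change (s * h)⁻¹ * RAAG.gen Γ v * (s * h) = h⁻¹ * RAAG.gen Γ v * h
    calc (s * h)⁻¹ * RAAG.gen Γ v * (s * h) = h⁻¹ * s⁻¹ * (RAAG.gen Γ v * s) * h := by group
      _ = _ := by rw [← hc]; group)

lemma extensionGraph_adj_mk {u w : V} (h : Γ.Adj u w) (g : RAAG Γ) :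
    (extensionGraph Γ).Adj (ExtVertex.mk u g) (ExtVertex.mk w g) := by
  refine ⟨fun e => h.ne (eq_of_conj_gen_eq (congrArg Subtype.val e)), ?_⟩
  have hc := (gen_commute h).eq
  change g⁻¹ * RAAG.gen Γ u * g * (g⁻¹ * RAAG.gen Γ w * g) =
    g⁻¹ * RAAG.gen Γ w * g * (g⁻¹ * RAAG.gen Γ u * g)
  calc _ = g⁻¹ * (RAAG.gen Γ u * RAAG.gen Γ w) * g := by group
    _ = _ := by rw [hc]; group

lemma extensionGraph_adj_smul {x y : ExtVertex Γ} (h : (extensionGraph Γ).Adj x y) (g : RAAG Γ) :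
    (extensionGraph Γ).Adj (x <• g) (y <• g) := by
  refine ⟨fun e => h.1 (MulAction.injective (MulOpposite.op g) e), ?_⟩
  have hc := h.2
  change g⁻¹ * x.1 * g * (g⁻¹ * y.1 * g) = g⁻¹ * y.1 * g * (g⁻¹ * x.1 * g)
  calc _ = g⁻¹ * (x.1 * y.1) * g := by group
    _ = _ := by rw [hc]; group

lemma reachable_mk_mk (hΓ : Γ.Connected) (u w : V) (g : RAAG Γ) :
    (extensionGraph Γ).Reachable (ExtVertex.mk u g) (ExtVertex.mk w g) := by
  let f : Γ →g extensionGraph Γ := ⟨fun v => ExtVertex.mk v g, fun h => extensionGraph_adj_mk h g⟩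
  exact (hΓ.preconnected u w).map f

/-- The conjugates of `Γ` by `l * g` and by `g` share the vertex of the letter `l`, which `l`
centralizes. -/
lemma extensionGraph_connected (hΓ : Γ.Connected) : (extensionGraph Γ).Connected := by
  obtain ⟨v⟩ := hΓ.nonempty
  have key : ∀ (W : List (V × Bool)) (u : V),
      (extensionGraph Γ).Reachable (ExtVertex.mk u (wordProd Γ W)) (ExtVertex.mk v 1) := by
    intro W
    induction W with
    | nil => exact fun u => reachable_mk_mk hΓ u v 1
    | cons l W ih =>
      intro u
      rw [wordProd_cons]
      have h := reachable_mk_mk hΓ u l.1 (letter Γ l * wordProd Γ W)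
      rw [ExtVertex.mk_mul_of_mem_star (letter_mem_spanSubgroup (Or.inl rfl))] at h
      exact h.trans (ih l.1)
  have key' : ∀ x : ExtVertex Γ, (extensionGraph Γ).Reachable x (ExtVertex.mk v 1) := by
    intro x
    obtain ⟨u, h, rfl⟩ := x.exists_eq_mk
    obtain ⟨W, rfl⟩ := wordProd_surjective Γ h
    exact key W u
  have : Nonempty (ExtVertex Γ) := ⟨ExtVertex.mk v 1⟩
  exact ⟨fun x y => (key' x).trans (key' y).symm⟩

lemma dist_smul_smul (hc : (extensionGraph Γ).Connected) (x y : ExtVertex Γ) (g : RAAG Γ) :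
    (extensionGraph Γ).dist (x <• g) (y <• g) = (extensionGraph Γ).dist x y := by
  have hle : ∀ (x y : ExtVertex Γ) (g : RAAG Γ),
      (extensionGraph Γ).dist (x <• g) (y <• g) ≤ (extensionGraph Γ).dist x y := by
    intro x y g
    let f : extensionGraph Γ →g extensionGraph Γ :=
      ⟨fun x => x <• g, fun h => extensionGraph_adj_smul h g⟩
    obtain ⟨p, hp⟩ := hc.exists_walk_length_eq_dist x y
    rw [← hp, ← SimpleGraph.Walk.length_map f p]
    exact SimpleGraph.dist_le _
  refine le_antisymm (hle x y g) ?_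
  have := hle (x <• g) (y <• g) g⁻¹
  simpa using this

/-- Fekete's lemma gives the asymptotic translation length. -/
lemma exists_isTranslationLength (hc : (extensionGraph Γ).Connected) (g : RAAG Γ) :
    ∃ t, IsTranslationLength (extensionGraph Γ) g t := by
  obtain ⟨x⟩ := hc.nonempty
  have hsub : Subadditive fun n : ℕ => ((extensionGraph Γ).dist (x <• g ^ n) x : ℝ) := by
    intro m n
    have h := hc.dist_triangle (u := x <• g ^ (m + n)) (v := x <• g ^ n) (w := x)
    rw [pow_add, MulOpposite.op_mul, mul_smul, dist_smul_smul hc] at h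
    beta_reduce
    rw [pow_add, MulOpposite.op_mul, mul_smul]
    exact_mod_cast h
  have hlim := hsub.tendsto_lim ⟨0, by rintro _ ⟨n, rfl⟩; positivity⟩
  refine ⟨hsub.lim, fun y => ?_⟩
  -- Changing the base point alters the displacement by at most `2 d(x, y)`, uniformly in `n`.
  have hdiff : Filter.Tendsto (fun n : ℕ => ((extensionGraph Γ).dist (y <• g ^ n) y : ℝ) / n -
      ((extensionGraph Γ).dist (x <• g ^ n) x : ℝ) / n) Filter.atTop (𝓝 0) := by
    refine squeeze_zero_norm (a := fun n : ℕ => 2 * ((extensionGraph Γ).dist x y : ℝ) / n)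
      (fun n => ?_) (tendsto_const_div_atTop_nhds_zero_nat _)
    rw [← sub_div, norm_div, Real.norm_natCast]
    gcongr
    have h1 := hc.dist_triangle (u := y <• g ^ n) (v := x <• g ^ n) (w := y)
    have h2 := hc.dist_triangle (u := x <• g ^ n) (v := x) (w := y)
    have h3 := hc.dist_triangle (u := x <• g ^ n) (v := y <• g ^ n) (w := x)
    have h4 := hc.dist_triangle (u := y <• g ^ n) (v := y) (w := x)
    rw [dist_smul_smul hc] at h1 h3
    rw [SimpleGraph.dist_comm (u := y) (v := x)] at h1 h4
    rw [Real.norm_eq_abs, abs_sub_le_iff]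
    constructor
    · rw [sub_le_iff_le_add]; norm_cast; omega
    · rw [sub_le_iff_le_add]; norm_cast; omega
  simpa using hdiff.add hlim

lemma IsTranslationLength.conj (hc : (extensionGraph Γ).Connected) {g : RAAG Γ} {t : ℝ}
    (h : IsTranslationLength (extensionGraph Γ) g t) (k : RAAG Γ) :
    IsTranslationLength (extensionGraph Γ) (k⁻¹ * g * k) t := by
  intro x
  refine (h (x <• k⁻¹)).congr fun n => ?_
  rw [← dist_smul_smul hc _ _ k]
  simp only [← mul_smul, ← MulOpposite.op_mul, inv_mul_cancel, MulOpposite.op_one, one_smul]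
  have : (k⁻¹ * g * k) ^ n = k⁻¹ * g ^ n * k := by
    simpa using conj_pow (i := n) (a := k⁻¹) (b := g)
  rw [this, mul_assoc]

lemma IsTranslationLength.nonpos_of_bounded {g : RAAG Γ} {t : ℝ}
    (h : IsTranslationLength (extensionGraph Γ) g t) {x : ExtVertex Γ} {B : ℕ}
    (hB : ∀ n, (extensionGraph Γ).dist (x <• g ^ n) x ≤ B) : t ≤ 0 := by
  refine le_of_tendsto_of_tendsto' (h x) (tendsto_const_div_atTop_nhds_zero_nat (B : ℝ))
    fun n => ?_
  gcongr
  exact_mod_cast hB n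

lemma commute_of_mem_spanSubgroup {A B : Set V} (hAB : ∀ u ∈ A, ∀ w ∈ B, Γ.Adj u w) {p q : RAAG Γ}
    (hp : p ∈ spanSubgroup Γ A) (hq : q ∈ spanSubgroup Γ B) : Commute p q := by
  induction hq using Subgroup.closure_induction with
  | mem x hx =>
    obtain ⟨w, hw, rfl⟩ := hx
    exact commute_gen_of_mem_star (Subgroup.closure_mono
      (Set.image_mono fun u hu => Or.inr (hAB u hu w hw).symm) hp)
  | one => exact Commute.one_right _
  | mul x y _ _ hx hy => exact hx.mul_right hy
  | inv x _ hx => exact hx.inv_right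

lemma exists_mul_of_join {A B : Set V} (hAB : ∀ u ∈ A, ∀ w ∈ B, Γ.Adj u w)
    {L : List (V × Bool)} (hL : ∀ l ∈ L, l.1 ∈ A ∨ l.1 ∈ B) :
    ∃ p ∈ spanSubgroup Γ A, ∃ q ∈ spanSubgroup Γ B, wordProd Γ L = p * q := by
  induction L with
  | nil => exact ⟨1, one_mem _, 1, one_mem _, by simp⟩
  | cons l L ih =>
    obtain ⟨p, hp, q, hq, h⟩ := ih fun m hm => hL m (by simp [hm])
    rw [wordProd_cons, h]
    rcases hL l (by simp) with hl | hl
    · exact ⟨letter Γ l * p, mul_mem (letter_mem_spanSubgroup hl) hp, q, hq, by group⟩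
    · have hlB := letter_mem_spanSubgroup (Γ := Γ) hl
      refine ⟨p, hp, letter Γ l * q, mul_mem hlB hq, ?_⟩
      rw [← mul_assoc, ← mul_assoc, (commute_of_mem_spanSubgroup hAB hp hlB).eq]

/-- Elements of a join subgroup have bounded orbits. -/
lemma dist_le_two_of_join {A B : Set V} (hAB : ∀ u ∈ A, ∀ w ∈ B, Γ.Adj u w) {a b : V}
    (ha : a ∈ A) (hb : b ∈ B) {L : List (V × Bool)} (hL : ∀ l ∈ L, l.1 ∈ A ∨ l.1 ∈ B) :
    (extensionGraph Γ).dist (ExtVertex.mk b 1 <• wordProd Γ L) (ExtVertex.mk b 1) ≤ 2 := by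
  obtain ⟨p, hp, q, hq, h⟩ := exists_mul_of_join hAB hL
  have h1 : ExtVertex.mk b 1 <• wordProd Γ L = ExtVertex.mk b q := by
    rw [ExtVertex.mk_smul, one_mul, h]
    exact ExtVertex.mk_mul_of_mem_star (Subgroup.closure_mono
      (Set.image_mono fun u hu => Or.inr (hAB u hu b hb).symm) hp) q
  have h2 : ExtVertex.mk (Γ := Γ) a q = ExtVertex.mk a 1 := by
    have := ExtVertex.mk_mul_of_mem_star (Γ := Γ) (v := a) (s := q) (Subgroup.closure_mono
      (Set.image_mono fun u hu => Or.inr (hAB a ha u hu)) hq) 1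
    rwa [mul_one] at this
  have e1 := extensionGraph_adj_mk (hAB a ha b hb).symm q
  have e2 := extensionGraph_adj_mk (hAB a ha b hb) 1
  rw [h2] at e1
  rw [h1]
  exact SimpleGraph.dist_le (.cons e1 (.cons e2 .nil))

lemma isReducedWord_of_positive {L : List (V × Bool)} (hL : ∀ l ∈ L, l.2 = true) :
    IsReducedWord Γ L := by
  rintro P Q R a e rfl
  have h1 := hL (a, e) (by simp)
  have h2 := hL (a, !e) (by simp)
  simp_all

variable [Fintype V]

lemma one_div_le_of_support (hcard : 3 ≤ Fintype.card V) [DecidableEq V]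
    (hc : (extensionGraph Γ).Connected) {W : List (V × Bool)}
    (hW : ∀ n, IsReducedWord Γ (wordPow W n)) (hco : IsCoconnected Γ {u | 0 < vcount u W})
    (hstar : ∀ v, ∃ u, 0 < vcount u W ∧ u ∉ closedStar Γ v) {t : ℝ}
    (ht : IsTranslationLength (extensionGraph Γ) (wordProd Γ W) t) :
    1 / ((Fintype.card V : ℝ) - 2) ≤ t := by
  obtain ⟨v⟩ : Nonempty V := Fintype.card_pos_iff.mp (by omega)
  refine ge_of_tendsto (ht (ExtVertex.mk v 1)) ?_
  filter_upwards [Filter.eventually_gt_atTop 0] with n hn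
  have h := le_dist_mul hcard (hW n) hco hstar hc v
  have h' : (n : ℝ) ≤ ((extensionGraph Γ).dist (ExtVertex.mk v 1 <• wordProd Γ W ^ n)
      (ExtVertex.mk v 1) : ℝ) * ((Fintype.card V : ℝ) - 2) := by
    have : ((Fintype.card V - 2 : ℕ) : ℝ) = (Fintype.card V : ℝ) - 2 := by
      rw [Nat.cast_sub (by omega)]; norm_num
    rw [← this]
    exact_mod_cast h
  have hV : (0 : ℝ) < (Fintype.card V : ℝ) - 2 := by
    have : (3 : ℝ) ≤ Fintype.card V := by exact_mod_cast hcard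
    linarith
  rw [div_le_div_iff₀ hV (by exact_mod_cast hn), one_mul]
  exact h'

/-- A support disconnected in the complement gives a join, whose subgroup moves a suitable vertex by
at most `2`; a support inside a star fixes its centre. Positivity excludes both. -/
lemma one_div_le_of_pos (hcard : 3 ≤ Fintype.card V) (hc : (extensionGraph Γ).Connected)
    {g : RAAG Γ} {t : ℝ} (ht : IsTranslationLength (extensionGraph Γ) g t) (hpos : 0 < t) :
    1 / ((Fintype.card V : ℝ) - 2) ≤ t := by
  classical
  obtain ⟨W, k, hWk, hW⟩ := exists_cyclically_reduced g
  have htW := ht.conj hc k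
  rw [← hWk] at htW
  have hmem : ∀ {n : ℕ} {l : V × Bool}, l ∈ wordPow W n → 0 < vcount l.1 W := fun h =>
    vcount_pos.mpr ⟨_, mem_wordPow h⟩
  refine one_div_le_of_support hcard hc hW ?_ ?_ htW
  · intro A ⟨a, haS, ha⟩ ⟨b, hbS, hb⟩
    by_contra! hno
    refine hpos.not_ge (htW.nonpos_of_bounded (x := ExtVertex.mk b 1) (B := 2) fun n => ?_)
    rw [← wordProd_wordPow]
    refine dist_le_two_of_join (A := {u | 0 < vcount u W ∧ u ∈ A})
      (B := {u | 0 < vcount u W ∧ u ∉ A}) (fun u hu w hw => hno u hu.1 w hw.1 hu.2 hw.2)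
      ⟨haS, ha⟩ ⟨hbS, hb⟩ fun l hl => ?_
    by_cases h : l.1 ∈ A
    · exact Or.inl ⟨hmem hl, h⟩
    · exact Or.inr ⟨hmem hl, h⟩
  · by_contra! hno
    obtain ⟨v, hv⟩ := hno
    refine hpos.not_ge (htW.nonpos_of_bounded (x := ExtVertex.mk v 1) (B := 0) fun n => ?_)
    rw [← wordProd_wordPow, ExtVertex.mk_smul, one_mul, ← mul_one (wordProd Γ _),
      ExtVertex.mk_mul_of_mem_star (wordProd_mem_spanSubgroup fun l hl => hv _ (hmem hl))]
    simp

/-- The product of all vertices is loxodromic. -/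
lemma exists_pos_isTranslationLength (hcard : 3 ≤ Fintype.card V)
    (hc : (extensionGraph Γ).Connected) (hcompl : Γᶜ.Connected) :
    ∃ (g : RAAG Γ) (t : ℝ), 0 < t ∧ IsTranslationLength (extensionGraph Γ) g t := by
  classical
  -- With positive letters only, nothing can cancel in any power, whatever the order of the
  -- vertices.
  let W : List (V × Bool) := Finset.univ.toList.map fun v => (v, true)
  have hsupp : ∀ u, 0 < vcount u W := fun u => vcount_pos.mpr ⟨true, by simp [W]⟩
  have hco : IsCoconnected Γ {u | 0 < vcount u W} := by
    intro A ⟨a, _, ha⟩ ⟨b, _, hb⟩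
    obtain ⟨p⟩ := hcompl.preconnected a b
    obtain ⟨d, -, h1, h2⟩ := p.exists_boundary_dart A ha hb
    exact ⟨_, hsupp _, _, hsupp _, h1, h2, (SimpleGraph.compl_adj _ _ _).mp d.adj |>.2⟩
  have hstar : ∀ v, ∃ u, 0 < vcount u W ∧ u ∉ closedStar Γ v := by
    intro v
    have : Nontrivial V := Fintype.one_lt_card_iff_nontrivial.mp (by omega)
    obtain ⟨w, hw⟩ := exists_ne v
    obtain ⟨u, -, x, -, hu, hx, hadj⟩ := hco {v} ⟨v, hsupp v, rfl⟩ ⟨w, hsupp w, hw⟩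
    rw [Set.mem_singleton_iff] at hu hx
    subst hu
    exact ⟨x, hsupp x, fun h => h.elim hx hadj⟩
  obtain ⟨t, ht⟩ := exists_isTranslationLength hc (wordProd Γ W)
  refine ⟨_, t, ?_, ht⟩
  refine lt_of_lt_of_le ?_ (one_div_le_of_support hcard hc (fun n =>
    isReducedWord_of_positive fun l hl => ?_) hco hstar ht)
  · have : (3 : ℝ) ≤ Fintype.card V := by exact_mod_cast hcard
    exact one_div_pos.mpr (by linarith)
  · have := mem_wordPow hl
    simp only [W, List.mem_map] at this
    obtain ⟨v, -, rfl⟩ := this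
    rfl

end Translation

end ExtensionGraph

theorem theoremB {V : Type*} [Fintype V] (Γ : SimpleGraph V)
    (hcard : 4 ≤ Fintype.card V) (hconn : Γ.Connected) (hcompl : Γᶜ.Connected) :
    (ExtensionGraph.extensionGraph Γ).Connected ∧
    (∀ g : ExtensionGraph.RAAG Γ,
      ∃! t : ℝ, ExtensionGraph.IsTranslationLength (ExtensionGraph.extensionGraph Γ) g t) ∧
    (ExtensionGraph.loxodromicLengths (ExtensionGraph.extensionGraph Γ)
      (⊤ : Subgroup (ExtensionGraph.RAAG Γ))).Nonempty ∧
    1 / ((Fintype.card V : ℝ) - 2) ≤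
      ExtensionGraph.minTranslationLength (ExtensionGraph.extensionGraph Γ)
        (⊤ : Subgroup (ExtensionGraph.RAAG Γ)) := by
  have hcard3 : 3 ≤ Fintype.card V := by omega
  have hc := ExtensionGraph.extensionGraph_connected hconn
  have hne : (ExtensionGraph.loxodromicLengths (ExtensionGraph.extensionGraph Γ)
      (⊤ : Subgroup (ExtensionGraph.RAAG Γ))).Nonempty := by
    obtain ⟨g, t, hpos, ht⟩ := ExtensionGraph.exists_pos_isTranslationLength hcard3 hc hcompl
    exact ⟨t, hpos, g, Subgroup.mem_top g, ht⟩
  refine ⟨hc, fun g => ?_, hne, ?_⟩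
  · obtain ⟨t, ht⟩ := ExtensionGraph.exists_isTranslationLength hc g
    obtain ⟨x⟩ := hc.nonempty
    exact ⟨t, ht, fun s hs => tendsto_nhds_unique (hs x) (ht x)⟩
  · refine le_csInf hne ?_
    rintro t ⟨hpos, g, -, ht⟩
    exact ExtensionGraph.one_div_le_of_pos hcard3 hc ht hpos
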